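/- Let $d\ge 1$ be an integer. For $A\subset\mathbb{R}^d$ and $r>0$ let $A_r=\{x\in\mathbb{R}^d : \operatorname{dist}(x,A)\le r\}$ be the closed $r$-parallel set (with $\emptyset_r=\emptyset$), let $\lambda_d$ be Lebesgue measure and $\mathcal{H}^{d-1}$ the $(d-1)$-dimensional Hausdorff measure (normalized to agree with Lebesgue measure on $\mathbb{R}^{d-1}$; counting measure if $d=1$), and put $\kappa_t=\pi^{t/2}/\Gamma(1+t/2)$. The lower Minkowski content and the lower S-content of $A$ are $$\underline{\mathcal M}^t(A)=\liminf_{r\to0+}\frac{\lambda_d(A_r)}{\kappa_{d-t}\,r^{d-t}},\qquad \underline{\mathcal S}^t(A)=\liminf_{r\to0+}\frac{\mathcal H^{d-1}(\partial A_r)}{(d-t)\,\kappa_{d-t}\,r^{d-1-t}}\quad(0\le t<d),\qquad \underline{\mathcal S}^d(A)=0,$$ and the lower Minkowski dimension and the lower S-dimension are $\underline{\dim}_M A=\inf\{t\ge0:\underline{\mathcal M}^t(A)=0\}$ and $\underline{\dim}_S A=\inf\{t\ge0:\underline{\mathcal S}^t(A)=0\}$. (i) For every real $c$ with $\frac{d-1}{d}<c\le1$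 there is a compact set $A\subset\mathbb{R}^d$ with $\lambda_d(A)=0$ and $\underline{\dim}_M A>0$ such that $$c\cdot\underline{\dim}_M A=\underline{\dim}_S A .$$ (ii) Consequently the constant $\frac{d-1}{d}$ in the known lower bound $\frac{d-1}{d}\,\underline{\dim}_M A\le\underline{\dim}_S A$ (for compact $A\subset\mathbb{R}^d$ with $\lambda_d(A)=0$) cannot be replaced by a larger one: if $c\in\mathbb{R}$ satisfies $c\cdot\underline{\dim}_M A\le\underline{\dim}_S A$ for every compact $A\subset\mathbb{R}^d$ with $\lambda_d(A)=0$, then $c\le\frac{d-1}{d}$. -/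

import Mathlib

open Filter Topology MeasureTheory
open scoped ENNReal

noncomputable section

namespace ParallelSets

/-- The constant `π ^ (t / 2) / Γ (1 + t / 2)`; for integers `t ≥ 0` it is the volume of the unit
ball of `ℝ^t`. -/
def kappa (t : ℝ) : ℝ := Real.pi ^ (t / 2) / Real.Gamma (1 + t / 2)

/-- The volume (Lebesgue measure) of the closed `r`-parallel set `{x | dist (x, A) ≤ r}`. -/
def parallelVolume {d : ℕ} (A : Set (EuclideanSpace ℝ (Fin d))) (r : ℝ) : ℝ≥0∞ :=
  volume (Metric.cthickening r A)

/-- The surface area of the closed `r`-parallel set: the `(d - 1)`-dimensional Hausdorff measure,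
normalized as in Euclidean geometry, of its topological boundary (used for `d ≥ 1`). -/
def parallelSurface {d : ℕ} (A : Set (EuclideanSpace ℝ (Fin d))) (r : ℝ) : ℝ≥0∞ :=
  Measure.euclideanHausdorffMeasure (d - 1) (frontier (Metric.cthickening r A))

/-- The lower `s`-dimensional Minkowski content, the lower limit as `r → 0+` of
`V (A_r) / (κ_{d-s} r ^ (d-s))`. -/
def lowerMinkowskiContent {d : ℕ} (s : ℝ) (A : Set (EuclideanSpace ℝ (Fin d))) : ℝ≥0∞ :=
  liminf (fun r : ℝ =>
    parallelVolume A r / ENNReal.ofReal (kappa ((d : ℝ) - s) * r ^ ((d : ℝ) - s))) (𝓝[>] 0)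

/-- The lower `s`-dimensional S-content, for `s < d` the lower limit as `r → 0+` of
`H^{d-1} (∂ A_r) / ((d-s) κ_{d-s} r ^ (d-1-s))`; by convention it is zero for `s = d`
(the value for `s > d` plays no role). -/
def lowerSContent {d : ℕ} (s : ℝ) (A : Set (EuclideanSpace ℝ (Fin d))) : ℝ≥0∞ :=
  if s < d then
    liminf (fun r : ℝ =>
      parallelSurface A r /
        ENNReal.ofReal (((d : ℝ) - s) * kappa ((d : ℝ) - s) * r ^ ((d : ℝ) - 1 - s))) (𝓝[>] 0)
  else 0

/-- The lower Minkowski dimension `inf {t ≥ 0 | lower t-dimensional Minkowski content of A is 0}`.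
For bounded `A` the set on the right is nonempty, since it contains every `t` with
`d < t < d + 2`. -/
def lowerMinkowskiDim {d : ℕ} (A : Set (EuclideanSpace ℝ (Fin d))) : ℝ :=
  sInf {t : ℝ | 0 ≤ t ∧ lowerMinkowskiContent t A = 0}

/-- The lower S-dimension `inf {t ≥ 0 | lower t-dimensional S-content of A is 0}`. -/
def lowerSDim {d : ℕ} (A : Set (EuclideanSpace ℝ (Fin d))) : ℝ :=
  sInf {t : ℝ | 0 ≤ t ∧ lowerSContent t A = 0}

end ParallelSets

end

namespace ParallelSets

/-! ### Hausdorff measure of spheres -/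

section

/-! Write `d = n + 1`. The example is a union of concentric spheres whose radii accumulate only at
`1`, with spacing `2 ^ (-b k)` between distances `2 ^ (-(k + 1))` and `2 ^ (-k)` from `1`. The
exponents satisfy `b (k + 1) ≈ b k / β` and `b k > k ^ 2`, so powers of `2 ^ k` are negligible
against any positive power of `2 ^ b k`.

Let `2 ^ (-b (k + 1)) ≤ 2 r < 2 ^ (-b k)`. The annulus of width `2 ^ (-(k + 1))` outside the unit
sphere is filled, so the volume is at least `r ^ ε` for small `r`, and the lower Minkowski dimension
is `d`. Gaps of block `k` are still open, so the boundary contains about `2 ^ (b k - k)` spheres;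
only the grid of spacing `2 ^ (-b k)` contributes besides the innermost sphere, so there are at most
`2 ^ (b k + 3)`. The surface is thus nearly constant, about `2 ^ b k`, while `r ^ (-β)` grows to
about the same size at the lower end of the range. Hence the lower S-dimension is `n + β`. Taking `β
= c d - (d - 1)` gives (i), and (ii) follows by applying (i) to a constant slightly above `(d - 1) /
d`. -/

theorem euclideanHausdorffMeasure_image_le_of_lipschitzOnWith {X Y : Type*} [MetricSpace X]
    [MeasurableSpace X] [BorelSpace X] [MetricSpace Y] [MeasurableSpace Y] [BorelSpace Y]
    {K : NNReal} {f : X → Y} {s : Set X} (hf : LipschitzOnWith K f s) (n : ℕ) :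
    Measure.euclideanHausdorffMeasure n (f '' s) ≤
      (K : ℝ≥0∞) ^ n * Measure.euclideanHausdorffMeasure n s := by
  have h := hf.hausdorffMeasure_image_le (d := n) (Nat.cast_nonneg n)
  rw [ENNReal.rpow_natCast] at h
  simp only [Measure.euclideanHausdorffMeasure_def, Measure.smul_apply, ENNReal.smul_def,
    smul_eq_mul]
  calc _ ≤ _ * ((K : ℝ≥0∞) ^ n * _) := mul_le_mul_right h _
    _ = _ := by ring

section Sphere

variable {E : Type*} [NormedAddCommGroup E] [InnerProductSpace ℝ E]

theorem closedBall_subset_image_sphere {v : E} (hv : ‖v‖ = 1) :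
    Metric.closedBall (0 : (ℝ ∙ v)ᗮ) 1 ⊆
      (ℝ ∙ v)ᗮ.orthogonalProjectionOnto '' Metric.sphere (0 : E) 1 := by
  intro w hw
  have hw1 : ‖(w : E)‖ ≤ 1 := by simpa using hw
  have hin : inner ℝ (w : E) (Real.sqrt (1 - ‖(w : E)‖ ^ 2) • v) = 0 := by
    rw [inner_smul_right, real_inner_comm, Submodule.mem_orthogonal_singleton_iff_inner_right.1 w.2,
      mul_zero]
  refine ⟨w + Real.sqrt (1 - ‖(w : E)‖ ^ 2) • v, ?_, ?_⟩
  · have h0 : (0 : ℝ) ≤ 1 - ‖(w : E)‖ ^ 2 := by nlinarith [norm_nonneg (w : E)]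
    have h := norm_add_sq_eq_norm_sq_add_norm_sq_of_inner_eq_zero _ _ hin
    rw [norm_smul, hv, mul_one, Real.norm_of_nonneg (Real.sqrt_nonneg _),
      Real.mul_self_sqrt h0] at h
    rw [mem_sphere_zero_iff_norm]
    nlinarith [norm_nonneg ((w : E) + Real.sqrt (1 - ‖(w : E)‖ ^ 2) • v)]
  · rw [map_add, map_smul, Submodule.orthogonalProjectionOnto_mem_subspace_eq_self,
      Submodule.orthogonalProjectionOnto_orthogonalComplement_singleton_eq_zero, smul_zero, add_zero]

/-- On the hemisphere away from the pole `v` the stereographic factor `2 / (1 - ⟪v, x⟫)` is at most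
`2`, so a bounded piece of the hyperplane suffices. -/
theorem hemisphere_subset_image {v : E} (hv : ‖v‖ = 1) :
    Metric.sphere (0 : E) 1 ∩ {x | inner ℝ v x ≤ 0} ⊆
      (fun w : (ℝ ∙ v)ᗮ => stereoInvFunAux v (w : E)) '' Metric.closedBall 0 2 := by
  rintro x ⟨hx, hvx⟩
  rw [Set.mem_ofPred_eq] at hvx
  refine ⟨stereoToFun v x, ?_, ?_⟩
  · rw [mem_closedBall_zero_iff, stereoToFun_apply, norm_smul]
    have h1 : ‖(ℝ ∙ v)ᗮ.orthogonalProjectionOnto x‖ ≤ 1 :=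
      ((ℝ ∙ v)ᗮ.norm_orthogonalProjectionOnto_apply_le x).trans_eq (by simpa using hx)
    have h2 : ‖2 / ((1 : ℝ) - innerSL ℝ v x)‖ ≤ 2 := by
      rw [innerSL_apply_apply, Real.norm_of_nonneg (by apply div_nonneg <;> linarith),
        div_le_iff₀ (by linarith)]
      linarith
    nlinarith [norm_nonneg ((ℝ ∙ v)ᗮ.orthogonalProjectionOnto x)]
  · have hxv : x ≠ v := by
      rintro rfl
      rw [real_inner_self_eq_norm_sq, hv] at hvx
      norm_num at hvx
    exact congrArg Subtype.val (stereo_left_inv hv (x := ⟨x, hx⟩) hxv)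

variable [MeasurableSpace E] [BorelSpace E] {n : ℕ}

theorem euclideanHausdorffMeasure_sphere_eq {r : ℝ} (hr : 0 < r) :
    Measure.euclideanHausdorffMeasure n (Metric.sphere (0 : E) r) =
      ENNReal.ofReal (r ^ n) * Measure.euclideanHausdorffMeasure n (Metric.sphere (0 : E) 1) := by
  have h := Measure.euclideanHausdorffMeasure_smul₀ n hr.ne' (Metric.sphere (0 : E) 1)
  rw [smul_sphere' hr.ne', smul_zero, Real.norm_of_nonneg hr.le, mul_one] at h
  rw [h, ENNReal.smul_def, smul_eq_mul, ← Real.toNNReal_eq_nnnorm_of_nonneg hr.le,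
    ENNReal.ofReal_pow hr.le, ENNReal.coe_pow]
  rfl

variable [FiniteDimensional ℝ E]

theorem isAddHaarMeasure_hyperplane (hn : Module.finrank ℝ E = n + 1) {v : E} (hv : v ≠ 0) :
    (Measure.euclideanHausdorffMeasure n : Measure (ℝ ∙ v)ᗮ).IsAddHaarMeasure := by
  have : Fact (Module.finrank ℝ E = n + 1) := ⟨hn⟩
  have h : Module.finrank ℝ (ℝ ∙ v)ᗮ = n := Submodule.finrank_orthogonal_span_singleton hv
  rw [← h]
  infer_instance

/-- Orthogonal projection to a hyperplane is 1-Lipschitz and maps the sphere onto a set containing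
the unit ball there. -/
theorem euclideanHausdorffMeasure_sphere_pos (hn : Module.finrank ℝ E = n + 1) :
    0 < Measure.euclideanHausdorffMeasure n (Metric.sphere (0 : E) 1) := by
  have : Nontrivial E := Module.nontrivial_of_finrank_pos (R := ℝ) (by omega)
  obtain ⟨v, hv⟩ := exists_norm_eq E (zero_le_one (α := ℝ))
  have := isAddHaarMeasure_hyperplane hn (v := v) (by rintro rfl; simp at hv)
  have hlip : LipschitzOnWith 1 (ℝ ∙ v)ᗮ.orthogonalProjectionOnto (Metric.sphere (0 : E) 1) :=
    (Submodule.lipschitzWith_orthogonalProjectionOnto _).lipschitzOnWith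
  have h := euclideanHausdorffMeasure_image_le_of_lipschitzOnWith hlip n
  rw [ENNReal.coe_one, one_pow, one_mul] at h
  exact ((Metric.measure_closedBall_pos _ _ one_pos).trans_le
    (measure_mono (closedBall_subset_image_sphere hv))).trans_le h

/-- Two opposite hemispheres cover the sphere, and each lies in a Lipschitz image of a ball in a
hyperplane. -/
theorem euclideanHausdorffMeasure_sphere_lt_top (hn : Module.finrank ℝ E = n + 1) :
    Measure.euclideanHausdorffMeasure n (Metric.sphere (0 : E) 1) < ⊤ := by
  have : Nontrivial E := Module.nontrivial_of_finrank_pos (R := ℝ) (by omega)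
  obtain ⟨v, hv⟩ := exists_norm_eq E (zero_le_one (α := ℝ))
  have key : ∀ u : E, ‖u‖ = 1 →
      Measure.euclideanHausdorffMeasure n (Metric.sphere (0 : E) 1 ∩ {x | inner ℝ u x ≤ 0}) < ⊤ := by
    intro u hu
    have := isAddHaarMeasure_hyperplane hn (v := u) (by rintro rfl; simp at hu)
    have hsm : ContDiff ℝ 1 (fun w : (ℝ ∙ u)ᗮ => stereoInvFunAux u (w : E)) :=
      contDiff_stereoInvFunAux.comp (ℝ ∙ u)ᗮ.subtypeL.contDiff
    obtain ⟨K, hK⟩ := hsm.contDiffOn.exists_lipschitzOnWith one_ne_zero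
      (convex_closedBall (0 : (ℝ ∙ u)ᗮ) 2) (isCompact_closedBall _ _)
    refine (measure_mono (hemisphere_subset_image hu)).trans_lt
      ((euclideanHausdorffMeasure_image_le_of_lipschitzOnWith hK n).trans_lt ?_)
    exact ENNReal.mul_lt_top (by simp) measure_closedBall_lt_top
  refine (measure_mono (t := (Metric.sphere (0 : E) 1 ∩ {x | inner ℝ v x ≤ 0}) ∪
    (Metric.sphere (0 : E) 1 ∩ {x | inner ℝ (-v) x ≤ 0})) fun x hx => ?_).trans_lt
      (measure_union_lt_top (key v hv) (key (-v) (by simpa using hv)))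
  rcases le_total (inner ℝ v x) 0 with h | h
  · exact Or.inl ⟨hx, h⟩
  · exact Or.inr ⟨hx, by simpa using h⟩

end Sphere

end

/-! ### The set of radii -/

section

/-- The compact set of radii: the number `1`, and for each `k` the points of
`[1 + 2 ^ (-(k + 1)), 1 + 2 ^ (-k)]` that differ from `1` by a multiple of `2 ^ (-b k)`. -/
def radii (b : ℕ → ℕ) : Set ℝ :=
  insert 1 {x | ∃ k m : ℕ, (1 / 2 : ℝ) ^ (k + 1) ≤ m * (1 / 2 : ℝ) ^ b k ∧
    m * (1 / 2 : ℝ) ^ b k ≤ (1 / 2 : ℝ) ^ k ∧ x = 1 + m * (1 / 2 : ℝ) ^ b k}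

variable {b : ℕ → ℕ}

theorem one_mem_radii : (1 : ℝ) ∈ radii b := Set.mem_insert _ _

theorem radii_subset_Icc : radii b ⊆ Set.Icc 1 2 := by
  rintro x (rfl | ⟨k, m, -, h, rfl⟩)
  · norm_num
  · have h1 : (1 / 2 : ℝ) ^ k ≤ 1 := pow_le_one₀ (by norm_num) (by norm_num)
    have h0 : (0 : ℝ) ≤ m * (1 / 2 : ℝ) ^ b k := by positivity
    exact ⟨by linarith, by linarith⟩

theorem radii_countable : (radii b).Countable := by
  refine Set.Countable.insert _ ((Set.countable_range
    fun p : ℕ × ℕ => 1 + (p.2 : ℝ) * (1 / 2 : ℝ) ^ b p.1).mono ?_)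
  rintro x ⟨k, m, -, -, rfl⟩
  exact ⟨(k, m), rfl⟩

theorem half_pow_eq {i j : ℕ} (h : i ≤ j) :
    (1 / 2 : ℝ) ^ i = ((2 ^ (j - i) : ℕ) : ℝ) * (1 / 2 : ℝ) ^ j := by
  obtain ⟨c, rfl⟩ := Nat.exists_eq_add_of_le h
  rw [Nat.add_sub_cancel_left, pow_add]
  push_cast
  have : (2 : ℝ) ^ c * (1 / 2 : ℝ) ^ c = 1 := by rw [← mul_pow]; norm_num
  linear_combination (-(1 / 2 : ℝ) ^ i) * this

/-- The dyadic grids are nested: blocks `j ≤ k` lie on the grid of block `k`, and a block `j > k`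
can meet this range only in the endpoint `1 + 2 ^ (-(k + 1))`, itself a grid point because `k + 1 ≤
b k`. -/
theorem exists_eq_of_mem_radii (hb : StrictMono b) (hb' : ∀ k, k + 1 ≤ b k) {x : ℝ} {k : ℕ}
    (hx : x ∈ radii b) (hxk : 1 + (1 / 2 : ℝ) ^ (k + 1) ≤ x) :
    ∃ m ∈ Finset.range (2 ^ b k + 1), x = 1 + (m : ℝ) * (1 / 2 : ℝ) ^ b k := by
  suffices h : ∃ m : ℕ, x = 1 + (m : ℝ) * (1 / 2 : ℝ) ^ b k by
    obtain ⟨m, rfl⟩ := h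
    refine ⟨m, ?_, rfl⟩
    have h2 := (radii_subset_Icc hx).2
    rw [Finset.mem_range, Nat.lt_succ_iff]
    have h3 : (m : ℝ) * (1 / 2 : ℝ) ^ b k ≤ (2 ^ b k : ℕ) * (1 / 2 : ℝ) ^ b k := by
      have := half_pow_eq (Nat.zero_le (b k))
      rw [Nat.sub_zero, pow_zero] at this
      linarith
    exact_mod_cast le_of_mul_le_mul_right h3 (by positivity)
  rcases hx with rfl | ⟨j, m, h1, h2, rfl⟩
  · have : (0 : ℝ) < (1 / 2) ^ (k + 1) := by positivity
    linarith
  rcases le_or_gt j k with hjk | hjk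
  · refine ⟨m * 2 ^ (b k - b j), ?_⟩
    rw [half_pow_eq (hb.monotone hjk)]
    push_cast
    ring
  · refine ⟨2 ^ (b k - (k + 1)), ?_⟩
    rw [← half_pow_eq (hb' k)]
    have : (1 / 2 : ℝ) ^ j ≤ (1 / 2) ^ (k + 1) :=
      pow_le_pow_of_le_one (by norm_num) (by norm_num) hjk
    linarith

theorem radii_finite (hb : StrictMono b) (hb' : ∀ k, k + 1 ≤ b k) (k : ℕ) :
    (radii b ∩ Set.Ici (1 + (1 / 2 : ℝ) ^ (k + 1))).Finite := by
  refine ((Finset.range (2 ^ b k + 1)).finite_toSet.image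
    fun m : ℕ => 1 + (m : ℝ) * (1 / 2 : ℝ) ^ b k).subset ?_
  rintro x ⟨hx, hxk⟩
  obtain ⟨m, hm, rfl⟩ := exists_eq_of_mem_radii hb hb' hx hxk
  exact ⟨m, hm, rfl⟩

theorem isCompact_radii (hb : StrictMono b) (hb' : ∀ k, k + 1 ≤ b k) : IsCompact (radii b) := by
  refine isCompact_Icc.of_isClosed_subset (isClosed_of_closure_subset fun x hx => ?_)
    radii_subset_Icc
  rcases (closure_minimal radii_subset_Icc isClosed_Icc hx).1.eq_or_lt with rfl | h1
  · exact one_mem_radii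
  obtain ⟨k, hk⟩ := exists_pow_lt_of_lt_one (sub_pos.2 h1) (show (1 / 2 : ℝ) < 1 by norm_num)
  have hk' : (1 / 2 : ℝ) ^ (k + 1) < x - 1 :=
    (pow_le_pow_of_le_one (by norm_num) (by norm_num) k.le_succ).trans_lt hk
  have hmem : x ∈ closure (radii b ∩ Set.Ioi (1 + (1 / 2 : ℝ) ^ (k + 1))) :=
    isOpen_Ioi.closure_inter ⟨hx, by rw [Set.mem_Ioi]; linarith⟩
  have hmem' := closure_mono (Set.inter_subset_inter_right _ Set.Ioi_subset_Ici_self) hmem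
  rw [(radii_finite hb hb' k).isClosed.closure_eq] at hmem'
  exact hmem'.1

theorem radii_gap (hb : StrictMono b) (hb' : ∀ k, k + 1 ≤ b k) {k m : ℕ}
    (hm : (1 / 2 : ℝ) ^ (k + 1) ≤ m * (1 / 2 : ℝ) ^ b k) {x : ℝ} (hx : x ∈ radii b) :
    x ≤ 1 + m * (1 / 2 : ℝ) ^ b k ∨ 1 + (m + 1 : ℝ) * (1 / 2 : ℝ) ^ b k ≤ x := by
  by_contra! h
  obtain ⟨j, -, rfl⟩ := exists_eq_of_mem_radii (k := k) hb hb' hx (by linarith)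
  have hpos : (0 : ℝ) < (1 / 2) ^ b k := by positivity
  have h1 : (m : ℝ) < j := lt_of_mul_lt_mul_right (by linarith [h.1]) hpos.le
  have h2 : (j : ℝ) < m + 1 := lt_of_mul_lt_mul_right (by linarith [h.2]) hpos.le
  norm_cast at h1 h2
  omega

/-- Rounding to the grid of the block `j ≥ k` containing `y` does not leave the block, since the
block's endpoints are grid points. -/
theorem exists_radii_near (hb : StrictMono b) (hb' : ∀ k, k + 1 ≤ b k) {k : ℕ} {y : ℝ}
    (hy : y ∈ Set.Icc (1 : ℝ) (1 + (1 / 2) ^ k)) :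
    ∃ x ∈ radii b, |y - x| ≤ (1 / 2 : ℝ) ^ b k / 2 := by
  rcases hy.1.eq_or_lt with rfl | h1
  · exact ⟨1, one_mem_radii, by rw [sub_self, abs_zero]; positivity⟩
  have hk1 : (1 / 2 : ℝ) ^ k ≤ 1 := pow_le_one₀ (by norm_num) (by norm_num)
  obtain ⟨j, hj1, hj2⟩ : ∃ j, (1 / 2 : ℝ) ^ (j + 1) < y - 1 ∧ y - 1 ≤ (1 / 2 : ℝ) ^ j :=
    exists_nat_pow_near_of_lt_one (sub_pos.2 h1) (by linarith [hy.2]) (by norm_num) (by norm_num)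
  have hkj : k ≤ j := by
    by_contra! h
    have : (1 / 2 : ℝ) ^ k ≤ (1 / 2) ^ (j + 1) :=
      pow_le_pow_of_le_one (by norm_num) (by norm_num) h
    linarith [hy.2]
  set g : ℝ := (1 / 2) ^ b j with hg
  have hgpos : 0 < g := by positivity
  have hround := abs_sub_round ((y - 1) / g)
  obtain ⟨hr1, hr2⟩ := abs_le.1 hround
  have e1 := half_pow_eq (hb' j)
  have e2 := half_pow_eq (show j ≤ b j by have := hb' j; omega)
  rw [← hg] at e1 e2
  have hlow : ((2 ^ (b j - (j + 1)) : ℕ) : ℤ) ≤ round ((y - 1) / g) := by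
    have : ((2 ^ (b j - (j + 1)) : ℕ) : ℝ) < (y - 1) / g := by rw [lt_div_iff₀ hgpos]; linarith
    have h3 : (((2 ^ (b j - (j + 1)) : ℕ) : ℤ) : ℝ) < ((round ((y - 1) / g) + 1 : ℤ) : ℝ) := by
      push_cast at this ⊢
      linarith
    exact Int.lt_add_one_iff.1 (by exact_mod_cast h3)
  have hupp : round ((y - 1) / g) ≤ ((2 ^ (b j - j) : ℕ) : ℤ) := by
    have : (y - 1) / g ≤ ((2 ^ (b j - j) : ℕ) : ℝ) := by rw [div_le_iff₀ hgpos]; linarith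
    have h3 : ((round ((y - 1) / g) : ℤ) : ℝ) < ((((2 ^ (b j - j) : ℕ) : ℤ) + 1 : ℤ) : ℝ) := by
      push_cast at this ⊢
      linarith
    exact Int.lt_add_one_iff.1 (by exact_mod_cast h3)
  obtain ⟨m, hm⟩ := Int.eq_ofNat_of_zero_le ((Int.natCast_nonneg _).trans hlow)
  rw [hm] at hlow hupp hr1 hr2
  have hlow' : ((2 ^ (b j - (j + 1)) : ℕ) : ℝ) ≤ m := by exact_mod_cast hlow
  have hupp' : (m : ℝ) ≤ ((2 ^ (b j - j) : ℕ) : ℝ) := by exact_mod_cast hupp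
  refine ⟨1 + m * g, Or.inr ⟨j, m, ?_, ?_, rfl⟩, ?_⟩
  · rw [e1]; exact mul_le_mul_of_nonneg_right hlow' hgpos.le
  · rw [e2]; exact mul_le_mul_of_nonneg_right hupp' hgpos.le
  · have hgk : g ≤ (1 / 2 : ℝ) ^ b k :=
      pow_le_pow_of_le_one (by norm_num) (by norm_num) (hb.monotone hkj)
    have h4 : y - (1 + m * g) = ((y - 1) / g - m) * g := by field_simp; ring
    rw [h4, abs_mul, abs_of_pos hgpos]
    have h5 : |(y - 1) / g - m| ≤ 1 / 2 := abs_le.2 ⟨by simpa using hr1, by simpa using hr2⟩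
    nlinarith

end

/-! ### Parallel sets of the radii and of the concentric spheres -/

section

section Concentric

variable {E : Type*} [NormedAddCommGroup E] [InnerProductSpace ℝ E] [FiniteDimensional ℝ E]

theorem isCompact_norm_preimage {R : Set ℝ} (hR : IsCompact R) :
    IsCompact ((fun x : E => ‖x‖) ⁻¹' R) := by
  obtain ⟨M, hM⟩ := hR.bddAbove
  refine (isCompact_closedBall (0 : E) M).of_isClosed_subset (hR.isClosed.preimage continuous_norm)
    fun x hx => ?_
  rw [mem_closedBall_zero_iff]
  exact hM hx

/-- The norm is 1-Lipschitz; conversely, moving along the ray through `x` changes the norm by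
exactly the distance moved. This reduces everything to dimension one. -/
theorem cthickening_norm_preimage [Nontrivial E] {R : Set ℝ} (hR : IsCompact R)
    (hR0 : R ⊆ Set.Ici 0) {r : ℝ} (hr : 0 ≤ r) :
    Metric.cthickening r ((fun x : E => ‖x‖) ⁻¹' R) =
      (fun x : E => ‖x‖) ⁻¹' Metric.cthickening r R := by
  ext x
  rw [(isCompact_norm_preimage hR).cthickening_eq_biUnion_closedBall hr, Set.mem_preimage,
    hR.cthickening_eq_biUnion_closedBall hr]
  simp only [Set.mem_iUnion, Set.mem_preimage, Metric.mem_closedBall, exists_prop]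
  constructor
  · rintro ⟨y, hy, hxy⟩
    refine ⟨‖y‖, hy, ?_⟩
    rw [Real.dist_eq]
    rw [dist_eq_norm] at hxy
    exact (abs_norm_sub_norm_le x y).trans hxy
  · rintro ⟨ρ, hρ, hxρ⟩
    have hρ0 : 0 ≤ ρ := hR0 hρ
    obtain ⟨u, hu, hxu⟩ : ∃ u : E, ‖u‖ = 1 ∧ x = ‖x‖ • u := by
      rcases eq_or_ne x 0 with rfl | hx
      · obtain ⟨u, hu⟩ := exists_norm_eq E (zero_le_one (α := ℝ))
        exact ⟨u, hu, by simp⟩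
      · refine ⟨‖x‖⁻¹ • x, norm_smul_inv_norm hx, ?_⟩
        rw [smul_smul, mul_inv_cancel₀ (norm_ne_zero_iff.2 hx), one_smul]
    refine ⟨ρ • u, ?_, ?_⟩
    · rwa [norm_smul, hu, mul_one, Real.norm_of_nonneg hρ0]
    · rw [dist_eq_norm]
      nth_rw 1 [hxu]
      rwa [← sub_smul, norm_smul, hu, mul_one, Real.norm_eq_abs, ← Real.dist_eq]

theorem measure_norm_preimage_eq_zero [MeasurableSpace E] [BorelSpace E] (μ : Measure E)
    [μ.IsAddHaarMeasure] [Nontrivial E] {R : Set ℝ} (hR : R.Countable) :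
    μ ((fun x : E => ‖x‖) ⁻¹' R) = 0 := by
  have h : (fun x : E => ‖x‖) ⁻¹' R = ⋃ ρ ∈ R, Metric.sphere (0 : E) ρ := by
    ext x
    simp
  rw [h, measure_biUnion_null_iff hR]
  exact fun ρ _ => Measure.addHaar_sphere μ 0 ρ

end Concentric

section RadiiParallel

variable {b : ℕ → ℕ}

theorem mem_cthickening_radii_iff (hb : StrictMono b) (hb' : ∀ k, k + 1 ≤ b k) {r : ℝ}
    (hr : 0 ≤ r) {y : ℝ} : y ∈ Metric.cthickening r (radii b) ↔ ∃ x ∈ radii b, |y - x| ≤ r := by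
  rw [(isCompact_radii hb hb').cthickening_eq_biUnion_closedBall hr]
  simp [Real.dist_eq]

theorem Icc_subset_cthickening_radii (hb : StrictMono b) (hb' : ∀ k, k + 1 ≤ b k) {k : ℕ} {r : ℝ}
    (hr : (1 / 2 : ℝ) ^ b k ≤ 2 * r) :
    Set.Icc (1 - r) (1 + (1 / 2) ^ k + r) ⊆ Metric.cthickening r (radii b) := by
  have hpos : (0 : ℝ) < (1 / 2) ^ b k := by positivity
  have hpos' : (0 : ℝ) < (1 / 2) ^ k := by positivity
  rintro y ⟨h1, h2⟩
  rw [mem_cthickening_radii_iff hb hb' (by linarith)]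
  rcases le_total y 1 with hy | hy
  · exact ⟨1, one_mem_radii, abs_le.2 ⟨by linarith, by linarith⟩⟩
  rcases le_total y (1 + (1 / 2) ^ k) with hy' | hy'
  · obtain ⟨x, hx, hxy⟩ := exists_radii_near hb hb' ⟨hy, hy'⟩
    exact ⟨x, hx, hxy.trans (by linarith)⟩
  · refine ⟨1 + (1 / 2) ^ k, ?_, abs_le.2 ⟨by linarith, by linarith⟩⟩
    have e := half_pow_eq (show k ≤ b k by have := hb' k; omega)
    refine Or.inr ⟨k, 2 ^ (b k - k), ?_, e.symm.le, by rw [← e]⟩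
    rw [← e]
    exact pow_le_pow_of_le_one (by norm_num) (by norm_num) k.le_succ

/-- A frontier point is at distance exactly `r` from a radius and avoids the open interval already
filled near `1`; only `1 - r` can lie below that interval. -/
theorem frontier_cthickening_radii_subset (hb : StrictMono b) (hb' : ∀ k, k + 1 ≤ b k) {k : ℕ}
    {r : ℝ} (hr : (1 / 2 : ℝ) ^ b k ≤ 2 * r) :
    frontier (Metric.cthickening r (radii b)) ⊆ insert (1 - r)
      ((fun x => x + r) '' (radii b ∩ Set.Ici (1 + (1 / 2 : ℝ) ^ k)) ∪
        (fun x => x - r) '' (radii b ∩ Set.Ici (1 + (1 / 2 : ℝ) ^ k))) := by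
  have hpos : (0 : ℝ) < (1 / 2) ^ b k := by positivity
  have hr0 : 0 < r := by linarith
  intro y hy
  obtain ⟨x, hx, hxy⟩ := (mem_cthickening_radii_iff hb hb' hr0.le).1
    (Metric.isClosed_cthickening.frontier_subset hy)
  have hint : y ∉ interior (Metric.cthickening r (radii b)) := hy.2
  have hx1 := (radii_subset_Icc hx).1
  have hyx : |y - x| = r := by
    by_contra hne
    refine hint (interior_mono (Metric.closedBall_subset_cthickening hx r)
      (Metric.ball_subset_interior_closedBall ?_))
    rw [Metric.mem_ball, Real.dist_eq]
    exact lt_of_le_of_ne hxy hne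
  have hyI : y ≤ 1 - r ∨ 1 + (1 / 2) ^ k + r ≤ y := by
    by_contra! h
    refine hint (interior_mono (Icc_subset_cthickening_radii hb hb' hr) ?_)
    rw [interior_Icc]
    exact h
  obtain ⟨hl, hu⟩ := abs_le.1 hxy
  rcases hyI with h | h
  · exact Or.inl (by linarith)
  · have hxk : x ∈ radii b ∩ Set.Ici (1 + (1 / 2 : ℝ) ^ k) :=
      ⟨hx, by rw [Set.mem_Ici]; linarith⟩
    rcases abs_cases (y - x) with ⟨h', -⟩ | ⟨h', -⟩
    · exact Or.inr (Or.inl ⟨x, hxk, by dsimp only; linarith⟩)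
    · exact Or.inr (Or.inr ⟨x, hxk, by dsimp only; linarith⟩)

theorem exists_finset_frontier_cthickening_radii (hb : StrictMono b) (hb' : ∀ k, k + 1 ≤ b k)
    {k : ℕ} {r : ℝ} (hr : (1 / 2 : ℝ) ^ b (k + 1) ≤ 2 * r) :
    ∃ s : Finset ℝ, frontier (Metric.cthickening r (radii b)) ⊆ s ∧ s.card ≤ 2 ^ (b k + 3) := by
  classical
  set t : Finset ℝ := (radii_finite hb hb' k).toFinset with ht
  have htc : t.card ≤ 2 ^ b k + 1 := by
    refine (Finset.card_le_card (t := (Finset.range (2 ^ b k + 1)).image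
      fun m : ℕ => 1 + (m : ℝ) * (1 / 2 : ℝ) ^ b k) fun x hx => ?_).trans
        (Finset.card_image_le.trans_eq (Finset.card_range _))
    rw [ht, Set.Finite.mem_toFinset] at hx
    obtain ⟨m, hm, rfl⟩ := exists_eq_of_mem_radii hb hb' hx.1 hx.2
    exact Finset.mem_image_of_mem _ hm
  refine ⟨insert (1 - r) (t.image (fun x => x + r) ∪ t.image (fun x => x - r)), ?_, ?_⟩
  · have := frontier_cthickening_radii_subset hb hb' hr
    simpa [ht] using this
  · refine (Finset.card_insert_le _ _).trans ?_
    have h1 := Finset.card_union_le (t.image (fun x => x + r)) (t.image (fun x => x - r))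
    have h2 : (t.image (fun x => x + r)).card ≤ t.card := Finset.card_image_le
    have h3 : (t.image (fun x => x - r)).card ≤ t.card := Finset.card_image_le
    have h4 : 1 ≤ 2 ^ b k := Nat.one_le_two_pow
    have h5 : 2 ^ (b k + 3) = 8 * 2 ^ b k := by ring
    omega

theorem notMem_cthickening_radii (hb : StrictMono b) (hb' : ∀ k, k + 1 ≤ b k) {k m : ℕ} {r y : ℝ}
    (hr : 0 ≤ r) (hm : (1 / 2 : ℝ) ^ (k + 1) ≤ m * (1 / 2 : ℝ) ^ b k)
    (h1 : 1 + m * (1 / 2 : ℝ) ^ b k + r < y) (h2 : y < 1 + (m + 1 : ℝ) * (1 / 2 : ℝ) ^ b k - r) :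
    y ∉ Metric.cthickening r (radii b) := by
  rw [mem_cthickening_radii_iff hb hb' hr]
  rintro ⟨x, hx, hxy⟩
  obtain ⟨hl, hu⟩ := abs_le.1 hxy
  rcases radii_gap hb hb' hm hx with h | h <;> linarith

theorem sphere_subset_frontier {E : Type*} [NormedAddCommGroup E] [InnerProductSpace ℝ E]
    [FiniteDimensional ℝ E] [Nontrivial E] (hb : StrictMono b) (hb' : ∀ k, k + 1 ≤ b k) {k m : ℕ}
    {r : ℝ} (hr : 0 ≤ r) (hrk : 2 * r < (1 / 2 : ℝ) ^ b k)
    (hm : m ∈ Finset.Ico (2 ^ (b k - (k + 1))) (2 ^ (b k - k))) :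
    Metric.sphere (0 : E) (1 + m * (1 / 2 : ℝ) ^ b k + r) ⊆
      frontier (Metric.cthickening r ((fun x : E => ‖x‖) ⁻¹' radii b)) := by
  have hpos : (0 : ℝ) < (1 / 2) ^ b k := by positivity
  rw [Finset.mem_Ico] at hm
  have e1 := half_pow_eq (hb' k)
  have e2 := half_pow_eq (show k ≤ b k by have := hb' k; omega)
  have hm1 : ((2 ^ (b k - (k + 1)) : ℕ) : ℝ) ≤ m := by exact_mod_cast hm.1
  have hm2 : (m : ℝ) ≤ ((2 ^ (b k - k) : ℕ) : ℝ) := by exact_mod_cast hm.2.le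
  have hmlow : (1 / 2 : ℝ) ^ (k + 1) ≤ m * (1 / 2 : ℝ) ^ b k := by
    rw [e1]; exact mul_le_mul_of_nonneg_right hm1 hpos.le
  have hmupp : m * (1 / 2 : ℝ) ^ b k ≤ (1 / 2 : ℝ) ^ k := by
    rw [e2]; exact mul_le_mul_of_nonneg_right hm2 hpos.le
  have hmem : 1 + m * (1 / 2 : ℝ) ^ b k ∈ radii b := Or.inr ⟨k, m, hmlow, hmupp, rfl⟩
  intro x hx
  rw [mem_sphere_zero_iff_norm] at hx
  have hxpos : 0 < ‖x‖ := by
    have : 0 ≤ m * (1 / 2 : ℝ) ^ b k := by positivity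
    linarith
  rw [cthickening_norm_preimage (isCompact_radii hb hb')
    (radii_subset_Icc.trans fun y hy => zero_le_one.trans hy.1) hr]
  refine ⟨subset_closure ?_, fun hint => ?_⟩
  · rw [Set.mem_preimage, mem_cthickening_radii_iff hb hb' hr]
    exact ⟨_, hmem, by rw [hx, add_sub_cancel_left, abs_of_nonneg hr]⟩
  -- Moving slightly outward enters the gap before the next radius, so `x` is not interior.
  have hcont : Tendsto (fun ε : ℝ => (1 + ε) • x) (𝓝[>] 0) (𝓝 x) := by
    have : Continuous fun ε : ℝ => (1 + ε) • x := by fun_prop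
    simpa using (this.tendsto 0).mono_left nhdsWithin_le_nhds
  have hev := hcont.eventually (mem_interior_iff_mem_nhds.1 hint)
  have hsmall : ∀ᶠ ε : ℝ in 𝓝[>] 0, ε ∈ Set.Ioo 0 (((1 / 2 : ℝ) ^ b k - 2 * r) / ‖x‖) :=
    Ioo_mem_nhdsGT (div_pos (by linarith) hxpos)
  obtain ⟨ε, hε, hε1, hε2⟩ := (hev.and hsmall).exists
  rw [lt_div_iff₀ hxpos] at hε2
  refine notMem_cthickening_radii hb hb' hr hmlow ?_ ?_ (Set.mem_preimage.1 hε) <;> dsimp only <;>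
    rw [norm_smul, Real.norm_of_nonneg (by linarith)]
  · nlinarith
  · linarith

end RadiiParallel

end

/-! ### Volume and surface bounds at a fixed scale -/

section

/-- The union of the spheres around the origin with radii in `radii b`. -/
def concentricSpheres (n : ℕ) (b : ℕ → ℕ) : Set (EuclideanSpace ℝ (Fin (n + 1))) :=
  (fun x => ‖x‖) ⁻¹' radii b

variable {n : ℕ} {b : ℕ → ℕ}

theorem isCompact_concentricSpheres (hb : StrictMono b) (hb' : ∀ k, k + 1 ≤ b k) :
    IsCompact (concentricSpheres n b) :=
  isCompact_norm_preimage (isCompact_radii hb hb')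

theorem volume_concentricSpheres : volume (concentricSpheres n b) = 0 :=
  measure_norm_preimage_eq_zero _ radii_countable

theorem cthickening_concentricSpheres (hb : StrictMono b) (hb' : ∀ k, k + 1 ≤ b k) {r : ℝ}
    (hr : 0 ≤ r) : Metric.cthickening r (concentricSpheres n b) =
      (fun x => ‖x‖) ⁻¹' Metric.cthickening r (radii b) :=
  cthickening_norm_preimage (isCompact_radii hb hb')
    (radii_subset_Icc.trans fun _ hy => zero_le_one.trans hy.1) hr

theorem le_parallelVolume_concentricSpheres (hb : StrictMono b) (hb' : ∀ k, k + 1 ≤ b k) {k : ℕ}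
    {r : ℝ} (hr : (1 / 2 : ℝ) ^ b k ≤ 2 * r) :
    ENNReal.ofReal (((1 / 2 : ℝ) ^ (k + 1)) ^ (n + 1)) *
        volume (Metric.ball (0 : EuclideanSpace ℝ (Fin (n + 1))) 1) ≤
      parallelVolume (concentricSpheres n b) r := by
  have hpos : (0 : ℝ) < (1 / 2) ^ b k := by positivity
  have hkpos : (0 : ℝ) < (1 / 2) ^ (k + 1) := by positivity
  -- The ball of radius `2 ^ (-(k + 1))` around a point halfway across the filled annulus lies in
  -- it.
  obtain ⟨u, hu⟩ := exists_norm_eq (EuclideanSpace ℝ (Fin (n + 1)))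
    (show (0 : ℝ) ≤ 1 + (1 / 2) ^ (k + 1) by positivity)
  have hball := Measure.addHaar_ball_of_pos
    (volume : Measure (EuclideanSpace ℝ (Fin (n + 1)))) u hkpos
  rw [finrank_euclideanSpace_fin] at hball
  rw [← hball]
  refine measure_mono fun x hx => ?_
  rw [cthickening_concentricSpheres hb hb' (by linarith), Set.mem_preimage]
  apply Icc_subset_cthickening_radii hb hb' hr
  rw [mem_ball_iff_norm] at hx
  obtain ⟨h1, h2⟩ := abs_le.1 ((abs_norm_sub_norm_le x u).trans hx.le)
  have h3 : (1 / 2 : ℝ) ^ k = 2 * (1 / 2) ^ (k + 1) := by ring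
  constructor <;> linarith

theorem le_parallelSurface_concentricSpheres (hb : StrictMono b) (hb' : ∀ k, k + 1 ≤ b k) {k : ℕ}
    {r : ℝ} (hr : 0 ≤ r) (hrk : 2 * r < (1 / 2 : ℝ) ^ b k) :
    ((2 ^ (b k - (k + 1)) : ℕ) : ℝ≥0∞) * Measure.euclideanHausdorffMeasure n
        (Metric.sphere (0 : EuclideanSpace ℝ (Fin (n + 1))) 1) ≤
      parallelSurface (concentricSpheres n b) r := by
  have hpos : (0 : ℝ) < (1 / 2) ^ b k := by positivity
  set t := Finset.Ico (2 ^ (b k - (k + 1))) (2 ^ (b k - k)) with ht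
  have htc : t.card = 2 ^ (b k - (k + 1)) := by
    have h1 : b k - k = b k - (k + 1) + 1 := by have := hb' k; omega
    rw [ht, Nat.card_Ico, h1, pow_succ]
    omega
  calc _ = ∑ _m ∈ t, Measure.euclideanHausdorffMeasure n
        (Metric.sphere (0 : EuclideanSpace ℝ (Fin (n + 1))) 1) := by
        rw [Finset.sum_const, htc, nsmul_eq_mul]
    _ ≤ ∑ m ∈ t, Measure.euclideanHausdorffMeasure n
        (Metric.sphere (0 : EuclideanSpace ℝ (Fin (n + 1))) (1 + m * (1 / 2 : ℝ) ^ b k + r)) := by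
        refine Finset.sum_le_sum fun m _ => ?_
        have h1 : 1 ≤ 1 + m * (1 / 2 : ℝ) ^ b k + r := by
          have : 0 ≤ m * (1 / 2 : ℝ) ^ b k := by positivity
          linarith
        rw [euclideanHausdorffMeasure_sphere_eq (zero_lt_one.trans_le h1)]
        exact le_mul_of_one_le_left' (ENNReal.one_le_ofReal.2 (one_le_pow₀ h1))
    _ = Measure.euclideanHausdorffMeasure n (⋃ m ∈ t,
        Metric.sphere (0 : EuclideanSpace ℝ (Fin (n + 1))) (1 + m * (1 / 2 : ℝ) ^ b k + r)) := by
        refine (measure_biUnion_finset (fun i _ j _ hij => ?_)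
          fun m _ => Metric.isClosed_sphere.measurableSet).symm
        refine Set.disjoint_left.2 fun x hxi hxj => hij ?_
        rw [mem_sphere_zero_iff_norm] at hxi hxj
        have h1 : (i : ℝ) * (1 / 2 : ℝ) ^ b k = j * (1 / 2 : ℝ) ^ b k := by linarith
        exact_mod_cast mul_right_cancel₀ hpos.ne' h1
    _ ≤ _ := measure_mono (Set.iUnion₂_subset fun m hm => sphere_subset_frontier hb hb' hr hrk hm)

theorem parallelSurface_concentricSpheres_le (hb : StrictMono b) (hb' : ∀ k, k + 1 ≤ b k) {k : ℕ}
    {r : ℝ} (hr : (1 / 2 : ℝ) ^ b (k + 1) ≤ 2 * r) (hr1 : r < 1) :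
    parallelSurface (concentricSpheres n b) r ≤ ((2 ^ (b k + 3) : ℕ) : ℝ≥0∞) *
      (ENNReal.ofReal (3 ^ n) * Measure.euclideanHausdorffMeasure n
        (Metric.sphere (0 : EuclideanSpace ℝ (Fin (n + 1))) 1)) := by
  classical
  have hpos : (0 : ℝ) < (1 / 2) ^ b (k + 1) := by positivity
  have hr0 : 0 ≤ r := by linarith
  obtain ⟨s, hs, hsc⟩ := exists_finset_frontier_cthickening_radii hb hb' hr
  -- Since the radii lie in `[1, 2]` and `r < 1`, boundary points have norm in `(0, 3]`.
  set t := s.filter fun ρ => 0 < ρ ∧ ρ ≤ 3 with ht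
  have hsub : frontier (Metric.cthickening r (concentricSpheres n b)) ⊆
      ⋃ ρ ∈ t, Metric.sphere 0 ρ := by
    intro x hx
    rw [cthickening_concentricSpheres hb hb' hr0] at hx
    have hx' : ‖x‖ ∈ frontier (Metric.cthickening r (radii b)) :=
      continuous_norm.frontier_preimage_subset _ hx
    obtain ⟨ρ, hρ, hxρ⟩ := (mem_cthickening_radii_iff hb hb' hr0).1
      (Metric.isClosed_cthickening.frontier_subset hx')
    obtain ⟨h1, h2⟩ := radii_subset_Icc hρ
    obtain ⟨h3, h4⟩ := abs_le.1 hxρ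
    refine Set.mem_biUnion (x := ‖x‖) ?_ (by simp)
    exact Finset.mem_coe.2 (Finset.mem_filter.2 ⟨hs hx', by linarith, by linarith⟩)
  calc parallelSurface (concentricSpheres n b) r
      ≤ Measure.euclideanHausdorffMeasure n (⋃ ρ ∈ t, Metric.sphere 0 ρ) := measure_mono hsub
    _ ≤ ∑ ρ ∈ t, Measure.euclideanHausdorffMeasure n (Metric.sphere 0 ρ) :=
        measure_biUnion_finset_le _ _
    _ ≤ ∑ _ρ ∈ t, ENNReal.ofReal (3 ^ n) * Measure.euclideanHausdorffMeasure n
        (Metric.sphere (0 : EuclideanSpace ℝ (Fin (n + 1))) 1) := by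
        refine Finset.sum_le_sum fun ρ hρ => ?_
        obtain ⟨-, h1, h2⟩ := Finset.mem_filter.1 hρ
        rw [euclideanHausdorffMeasure_sphere_eq h1]
        exact mul_le_mul_left (ENNReal.ofReal_le_ofReal (pow_le_pow_left₀ h1.le h2 n)) _
    _ ≤ _ := by
        rw [Finset.sum_const, nsmul_eq_mul]
        refine mul_le_mul_left ?_ _
        exact_mod_cast (Finset.card_filter_le _ _).trans hsc

end

/-! ### Choice of scales and asymptotics -/

section

/-- Exponents growing at least quadratically, with `scaleExponent β (k + 1)` asymptotic to
`scaleExponent β k / β`. -/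
noncomputable def scaleExponent (β : ℝ) : ℕ → ℕ
  | 0 => 1
  | k + 1 => ⌈(scaleExponent β k : ℝ) / β⌉₊ + (2 * k + 1)

section ScaleExponent

variable {β : ℝ}

theorem scaleExponent_div_le (k : ℕ) :
    (scaleExponent β k : ℝ) / β ≤ scaleExponent β (k + 1) := by
  rw [scaleExponent]
  push_cast
  have := Nat.le_ceil ((scaleExponent β k : ℝ) / β)
  have hk : (0 : ℝ) ≤ k := k.cast_nonneg
  linarith

theorem scaleExponent_succ_le (hβ : 0 < β) (k : ℕ) :
    (scaleExponent β (k + 1) : ℝ) ≤ scaleExponent β k / β + (2 * k + 2) := by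
  rw [scaleExponent]
  push_cast
  have := Nat.ceil_lt_add_one (show 0 ≤ (scaleExponent β k : ℝ) / β by positivity)
  linarith

theorem scaleExponent_add_le (hβ : 0 < β) (hβ1 : β ≤ 1) (k : ℕ) :
    scaleExponent β k + (2 * k + 1) ≤ scaleExponent β (k + 1) := by
  rw [scaleExponent]
  refine Nat.add_le_add_right ((Nat.cast_le (α := ℝ)).1 (le_trans ?_ (Nat.le_ceil _))) _
  rw [le_div_iff₀ hβ]
  exact mul_le_of_le_one_right (Nat.cast_nonneg _) hβ1

theorem strictMono_scaleExponent (hβ : 0 < β) (hβ1 : β ≤ 1) : StrictMono (scaleExponent β) :=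
  strictMono_nat_of_lt_succ fun k => by
    have := scaleExponent_add_le hβ hβ1 k
    omega

/-- The increments `2 * k + 1` sum to the squares; this forces superlinear growth even when `β = 1`.
-/
theorem sq_lt_scaleExponent (hβ : 0 < β) (hβ1 : β ≤ 1) (k : ℕ) : k ^ 2 < scaleExponent β k := by
  induction k with
  | zero => simp [scaleExponent]
  | succ k ih =>
    have := scaleExponent_add_le hβ hβ1 k
    nlinarith

theorem succ_le_scaleExponent (hβ : 0 < β) (hβ1 : β ≤ 1) (k : ℕ) : k + 1 ≤ scaleExponent β k := by
  have := sq_lt_scaleExponent hβ hβ1 k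
  nlinarith

theorem eventually_linear_le_scaleExponent (hβ : 0 < β) (hβ1 : β ≤ 1) (C : ℝ) {δ : ℝ}
    (hδ : 0 < δ) : ∀ᶠ k : ℕ in atTop, C * (k + 2) ≤ δ * scaleExponent β k := by
  filter_upwards [eventually_ge_atTop 1, eventually_ge_atTop ⌈3 * |C| / δ⌉₊] with k hk1 hk
  have hk1' : (1 : ℝ) ≤ k := by exact_mod_cast hk1
  have hk' : 3 * |C| ≤ k * δ := (div_le_iff₀ hδ).1 ((Nat.le_ceil _).trans (by exact_mod_cast hk))
  have hsq : (k : ℝ) ^ 2 ≤ scaleExponent β k := by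
    exact_mod_cast (sq_lt_scaleExponent hβ hβ1 k).le
  calc C * (k + 2) ≤ |C| * (3 * k) := by
        refine (mul_le_mul_of_nonneg_right (le_abs_self C) (by positivity)).trans
          (mul_le_mul_of_nonneg_left (by linarith) (abs_nonneg C))
    _ = 3 * |C| * k := by ring
    _ ≤ k * δ * k := by gcongr
    _ = δ * (k : ℝ) ^ 2 := by ring
    _ ≤ _ := by gcongr

theorem exists_scale {b : ℕ → ℕ} (hb' : ∀ k, k + 1 ≤ b k) {K : ℕ} {r : ℝ} (hr : 0 < r)
    (hrK : 2 * r < (1 / 2 : ℝ) ^ b K) :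
    ∃ k ≥ K, (1 / 2 : ℝ) ^ b (k + 1) ≤ 2 * r ∧ 2 * r < (1 / 2 : ℝ) ^ b k := by
  by_contra! h
  have hall : ∀ k ≥ K, 2 * r < (1 / 2 : ℝ) ^ b k := by
    intro k hk
    induction k, hk using Nat.le_induction with
    | base => exact hrK
    | succ k hk ih =>
      by_contra! h'
      exact absurd ih (h k hk h').not_gt
  obtain ⟨m, hm⟩ := exists_pow_lt_of_lt_one (show 0 < 2 * r by positivity)
    (show (1 / 2 : ℝ) < 1 by norm_num)
  have h1 := hall (max m K) (le_max_right _ _)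
  have h2 : (1 / 2 : ℝ) ^ b (max m K) ≤ (1 / 2) ^ m :=
    pow_le_pow_of_le_one (by norm_num) (by norm_num)
      ((le_max_left m K).trans ((Nat.le_succ _).trans (hb' _)))
  linarith

theorem eventually_exists_scale {b : ℕ → ℕ} (hb' : ∀ k, k + 1 ≤ b k) {p : ℕ → Prop}
    (hp : ∀ᶠ k in atTop, p k) : ∀ᶠ r : ℝ in 𝓝[>] 0, 0 < r ∧ ∃ k, p k ∧
      (1 / 2 : ℝ) ^ b (k + 1) ≤ 2 * r ∧ 2 * r < (1 / 2 : ℝ) ^ b k := by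
  obtain ⟨K, hK⟩ := eventually_atTop.1 hp
  filter_upwards [Ioo_mem_nhdsGT (show (0 : ℝ) < (1 / 2) ^ b K / 2 by positivity)] with r hr
  obtain ⟨k, hk, h⟩ := exists_scale hb' hr.1 (show 2 * r < (1 / 2 : ℝ) ^ b K by linarith [hr.2])
  exact ⟨hr.1, k, hK k hk, h⟩

theorem half_pow_rpow_neg (N : ℕ) (s : ℝ) : ((1 / 2 : ℝ) ^ N) ^ (-s) = (2 : ℝ) ^ (N * s) := by
  rw [one_div, inv_pow, Real.inv_rpow (by positivity), ← Real.rpow_neg (by positivity), neg_neg,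
    ← Real.rpow_natCast, ← Real.rpow_mul (by norm_num)]

end ScaleExponent

section Asymptotics

variable {n : ℕ} {β : ℝ}

theorem eventually_le_parallelVolume (hβ : 0 < β) (hβ1 : β ≤ 1) {ε : ℝ} (hε : 0 < ε) :
    ∃ c : ℝ, 0 < c ∧ ∀ᶠ r : ℝ in 𝓝[>] 0, ENNReal.ofReal (c * r ^ ε) ≤
      parallelVolume (concentricSpheres n (scaleExponent β)) r := by
  set v := volume (Metric.ball (0 : EuclideanSpace ℝ (Fin (n + 1))) 1) with hv
  have hvtop : v ≠ ⊤ := measure_ball_lt_top.ne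
  have hv0 : v ≠ 0 := (Metric.measure_ball_pos _ _ one_pos).ne'
  have hb := strictMono_scaleExponent hβ hβ1
  have hb' := succ_le_scaleExponent hβ hβ1
  refine ⟨v.toReal, ENNReal.toReal_pos hv0 hvtop, ?_⟩
  -- The filled annulus gives volume of order `2 ^ (-(k + 2) * (n + 1))`, and quadratic growth of
  -- the exponents makes this at least `r ^ ε`.
  filter_upwards [eventually_exists_scale hb'
    (eventually_linear_le_scaleExponent hβ hβ1 (n + 1) hε)] with r hr
  obtain ⟨hr0, k, hk, h1, h2⟩ := hr
  refine le_trans ?_ (le_parallelVolume_concentricSpheres hb hb' h1)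
  rw [← hv, mul_comm, ENNReal.ofReal_mul (by positivity), ENNReal.ofReal_toReal hvtop]
  refine mul_le_mul_left (ENNReal.ofReal_le_ofReal ?_) _
  calc r ^ ε ≤ ((1 / 2 : ℝ) ^ scaleExponent β k) ^ ε :=
        Real.rpow_le_rpow hr0.le (by linarith) hε.le
    _ = (1 / 2 : ℝ) ^ (scaleExponent β k * ε) := by
        rw [← Real.rpow_natCast, ← Real.rpow_mul (by norm_num)]
    _ ≤ (1 / 2 : ℝ) ^ (((k + 1 + 1) * (n + 1) : ℕ) : ℝ) := by
        refine Real.rpow_le_rpow_of_exponent_ge (by norm_num) (by norm_num) ?_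
        push_cast
        linarith
    _ = _ := by rw [Real.rpow_natCast, pow_mul]

theorem eventually_le_parallelSurface (hβ : 0 < β) (hβ1 : β ≤ 1) {s : ℝ} (hs : 0 ≤ s)
    (hsβ : s < β) : ∃ c : ℝ, 0 < c ∧ ∀ᶠ r : ℝ in 𝓝[>] 0, ENNReal.ofReal (c * r ^ (-s)) ≤
      parallelSurface (concentricSpheres n (scaleExponent β)) r := by
  set h := Measure.euclideanHausdorffMeasure n
    (Metric.sphere (0 : EuclideanSpace ℝ (Fin (n + 1))) 1) with hh
  have htop : h ≠ ⊤ := (euclideanHausdorffMeasure_sphere_lt_top finrank_euclideanSpace_fin).ne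
  have h0 : h ≠ 0 := (euclideanHausdorffMeasure_sphere_pos finrank_euclideanSpace_fin).ne'
  have hb := strictMono_scaleExponent hβ hβ1
  have hb' := succ_le_scaleExponent hβ hβ1
  refine ⟨h.toReal, ENNReal.toReal_pos h0 htop, ?_⟩
  -- The slack `(1 - s / β) * b k` must absorb `k + 1` from the sphere count and `2 * k + 3` from
  -- the rounding in `b (k + 1)`.
  filter_upwards [eventually_exists_scale hb' (eventually_linear_le_scaleExponent hβ hβ1 3
    (show 0 < 1 - s / β by rw [sub_pos, div_lt_one hβ]; exact hsβ))] with r hr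
  obtain ⟨hr0, k, hk, h1, h2⟩ := hr
  refine le_trans ?_ (le_parallelSurface_concentricSpheres hb hb' hr0.le h2)
  rw [← hh, mul_comm, ENNReal.ofReal_mul (by positivity), ENNReal.ofReal_toReal htop]
  refine mul_le_mul_left ?_ _
  rw [← ENNReal.ofReal_natCast]
  refine ENNReal.ofReal_le_ofReal ?_
  have hsucc := scaleExponent_succ_le hβ k
  calc r ^ (-s) ≤ ((1 / 2 : ℝ) ^ (scaleExponent β (k + 1) + 1)) ^ (-s) := by
        refine Real.rpow_le_rpow_of_nonpos (by positivity) ?_ (by linarith)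
        rw [pow_succ]
        linarith
    _ = (2 : ℝ) ^ (((scaleExponent β (k + 1) + 1 : ℕ) : ℝ) * s) := half_pow_rpow_neg _ _
    _ ≤ (2 : ℝ) ^ ((scaleExponent β k - (k + 1) : ℕ) : ℝ) := by
        refine Real.rpow_le_rpow_of_exponent_le (by norm_num) ?_
        rw [Nat.cast_sub (hb' k)]
        push_cast
        have h3 : (scaleExponent β (k + 1) + 1 : ℝ) * s ≤
            (scaleExponent β k / β + (2 * k + 3)) * s :=
          mul_le_mul_of_nonneg_right (by linarith) hs
        have h4 : (2 * k + 3 : ℝ) * s ≤ 2 * k + 3 :=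
          mul_le_of_le_one_right (by positivity) (by linarith)
        have h5 : (scaleExponent β k : ℝ) / β * s = scaleExponent β k * (s / β) := by ring
        nlinarith
    _ = _ := by rw [Real.rpow_natCast]; push_cast; rfl

theorem frequently_parallelSurface_le (hβ : 0 < β) (hβ1 : β ≤ 1) {s : ℝ} (hsβ : β < s) {η : ℝ}
    (hη : 0 < η) : ∃ᶠ r : ℝ in 𝓝[>] 0,
      parallelSurface (concentricSpheres n (scaleExponent β)) r ≤
        ENNReal.ofReal (η * r ^ (-s)) := by
  set h := ENNReal.ofReal (3 ^ n) * Measure.euclideanHausdorffMeasure n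
    (Metric.sphere (0 : EuclideanSpace ℝ (Fin (n + 1))) 1) with hh
  have htop : h ≠ ⊤ := ENNReal.mul_ne_top ENNReal.ofReal_ne_top
    (euclideanHausdorffMeasure_sphere_lt_top finrank_euclideanSpace_fin).ne
  have hb := strictMono_scaleExponent hβ hβ1
  have hb' := succ_le_scaleExponent hβ hβ1
  have hθ : 0 < s / β - 1 := by rw [sub_pos, one_lt_div hβ]; exact hsβ
  have hexp : Tendsto (fun k => scaleExponent β k + 1) atTop atTop :=
    (tendsto_add_atTop_nat 1).comp hb.tendsto_atTop
  -- These radii satisfy `2 r = 2 ^ (-b (k + 1))`: the lower end of a scale, where the surface is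
  -- smallest relative to `r ^ (-s)`.
  have hr : Tendsto (fun k => (1 / 2 : ℝ) ^ (scaleExponent β (k + 1) + 1)) atTop (𝓝[>] 0) := by
    refine tendsto_nhdsWithin_iff.2 ⟨?_, Eventually.of_forall fun k => by
      rw [Set.mem_Ioi]; positivity⟩
    exact (tendsto_pow_atTop_nhds_zero_of_lt_one (by norm_num) (by norm_num)).comp
      (hexp.comp (tendsto_add_atTop_nat 1))
  refine hr.frequently (Eventually.frequently ?_)
  have hgrow : Tendsto (fun k => (2 : ℝ) ^ ((s / β - 1) * scaleExponent β k)) atTop atTop :=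
    (tendsto_rpow_atTop_of_base_gt_one 2 (by norm_num)).comp
      ((tendsto_natCast_atTop_atTop.comp hb.tendsto_atTop).const_mul_atTop hθ)
  filter_upwards [hgrow.eventually_ge_atTop (8 * h.toReal / η)] with k hk
  rw [div_le_iff₀ hη] at hk
  refine (parallelSurface_concentricSpheres_le (k := k) hb hb' (by rw [pow_succ]; linarith)
    (pow_lt_one₀ (by norm_num) (by norm_num) (by omega))).trans ?_
  rw [← hh, ← ENNReal.ofReal_toReal htop, ← ENNReal.ofReal_natCast,
    ← ENNReal.ofReal_mul (by positivity)]
  refine ENNReal.ofReal_le_ofReal ?_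
  rw [half_pow_rpow_neg]
  have hle : (2 : ℝ) ^ ((s / β - 1) * scaleExponent β k + scaleExponent β k) ≤
      (2 : ℝ) ^ (((scaleExponent β (k + 1) + 1 : ℕ) : ℝ) * s) := by
    refine Real.rpow_le_rpow_of_exponent_le (by norm_num) ?_
    have h1 := scaleExponent_div_le (β := β) k
    have h2 : (s / β - 1) * scaleExponent β k + scaleExponent β k =
        (scaleExponent β k : ℝ) / β * s := by ring
    rw [h2]
    refine mul_le_mul_of_nonneg_right ?_ (by linarith)
    push_cast
    linarith
  rw [Real.rpow_add (by norm_num), Real.rpow_natCast] at hle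
  calc ((2 ^ (scaleExponent β k + 3) : ℕ) : ℝ) * h.toReal
      = 8 * h.toReal * 2 ^ scaleExponent β k := by push_cast; ring
    _ ≤ (2 : ℝ) ^ ((s / β - 1) * scaleExponent β k) * η * 2 ^ scaleExponent β k := by gcongr
    _ = η * ((2 : ℝ) ^ ((s / β - 1) * scaleExponent β k) * 2 ^ scaleExponent β k) := by ring
    _ ≤ _ := by gcongr

end Asymptotics

end

/-! ### Contents, dimensions and the choice of `β` -/

section

theorem kappa_pos {t : ℝ} (ht : 0 ≤ t) : 0 < kappa t :=
  div_pos (Real.rpow_pos_of_pos Real.pi_pos _) (Real.Gamma_pos_of_pos (by linarith))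

theorem liminf_div_ne_zero {f : ℝ → ℝ≥0∞} {c D p : ℝ} (hc : 0 < c) (hD : 0 < D)
    (h : ∀ᶠ r : ℝ in 𝓝[>] 0, ENNReal.ofReal (c * r ^ p) ≤ f r) :
    liminf (fun r : ℝ => f r / ENNReal.ofReal (D * r ^ p)) (𝓝[>] 0) ≠ 0 := by
  have hle : ENNReal.ofReal (c / D) ≤
      liminf (fun r : ℝ => f r / ENNReal.ofReal (D * r ^ p)) (𝓝[>] 0) := by
    refine le_liminf_of_le (by isBoundedDefault) ?_
    filter_upwards [h, self_mem_nhdsWithin] with r hr (hr0 : 0 < r)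
    have hrp : 0 < r ^ p := Real.rpow_pos_of_pos hr0 p
    rw [ENNReal.le_div_iff_mul_le (Or.inl (ENNReal.ofReal_pos.2 (by positivity)).ne')
      (Or.inl ENNReal.ofReal_ne_top), ← ENNReal.ofReal_mul (by positivity)]
    convert hr using 2
    field_simp
  exact ((ENNReal.ofReal_pos.2 (div_pos hc hD)).trans_le hle).ne'

theorem liminf_div_eq_zero {f : ℝ → ℝ≥0∞} {D p : ℝ} (hD : 0 < D)
    (h : ∀ η : ℝ, 0 < η → ∃ᶠ r : ℝ in 𝓝[>] 0, f r ≤ ENNReal.ofReal (η * r ^ p)) :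
    liminf (fun r : ℝ => f r / ENNReal.ofReal (D * r ^ p)) (𝓝[>] 0) = 0 := by
  refine le_antisymm (ENNReal.le_of_forall_pos_le_add fun η hη _ => ?_) zero_le
  rw [zero_add]
  refine liminf_le_of_frequently_le' ?_
  refine ((h (η * D) (by positivity)).and_eventually self_mem_nhdsWithin).mono ?_
  rintro r ⟨hr, hr0 : 0 < r⟩
  refine ENNReal.div_le_of_le_mul (hr.trans_eq ?_)
  have hrp : 0 < r ^ p := Real.rpow_pos_of_pos hr0 p
  rw [mul_assoc, ENNReal.ofReal_mul η.coe_nonneg, ENNReal.ofReal_coe_nnreal]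

theorem lowerMinkowskiContent_natCast_eq_zero {d : ℕ} {A : Set (EuclideanSpace ℝ (Fin d))}
    (hA : IsCompact A) (hA0 : volume A = 0) : lowerMinkowskiContent d A = 0 := by
  have h := tendsto_measure_cthickening_of_isCompact (μ := volume) hA
  rw [hA0] at h
  have h' := (h.mono_left (nhdsWithin_le_nhds (s := Set.Ioi 0))).liminf_eq
  -- For exponent `d` the normalization is `kappa 0 * r ^ 0 = 1`, leaving the volume alone.
  simpa [lowerMinkowskiContent, parallelVolume, kappa] using h'

theorem lowerMinkowskiDim_eq_of_forall_ne_zero {d : ℕ} {A : Set (EuclideanSpace ℝ (Fin d))}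
    (hA : IsCompact A) (hA0 : volume A = 0)
    (h : ∀ s : ℝ, s < d → lowerMinkowskiContent s A ≠ 0) : lowerMinkowskiDim A = d :=
  IsLeast.csInf_eq ⟨⟨Nat.cast_nonneg d, lowerMinkowskiContent_natCast_eq_zero hA hA0⟩,
    fun s hs => not_lt.1 fun hsd => h s hsd hs.2⟩

variable {n : ℕ} {β : ℝ}

theorem lowerMinkowskiDim_concentricSpheres (hβ : 0 < β) (hβ1 : β ≤ 1) :
    lowerMinkowskiDim (concentricSpheres n (scaleExponent β)) = (n + 1 : ℕ) := by
  refine lowerMinkowskiDim_eq_of_forall_ne_zero (isCompact_concentricSpheres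
    (strictMono_scaleExponent hβ hβ1) (succ_le_scaleExponent hβ hβ1)) volume_concentricSpheres
    fun s hs => ?_
  obtain ⟨c, hc, h⟩ := eventually_le_parallelVolume (n := n) hβ hβ1 (sub_pos.2 hs)
  exact liminf_div_ne_zero hc (kappa_pos (sub_pos.2 hs).le) h

theorem lowerSContent_concentricSpheres_ne_zero (hβ : 0 < β) (hβ1 : β ≤ 1) {s : ℝ}
    (hs : s < n + β) : lowerSContent s (concentricSpheres n (scaleExponent β)) ≠ 0 := by
  have hsd : s < (n + 1 : ℕ) := by push_cast; linarith
  rw [lowerSContent, if_pos hsd]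
  -- The surface bound needs a nonnegative exponent; for `r < 1`, truncating `s - n` at `0` only
  -- strengthens it.
  obtain ⟨c, hc, h⟩ := eventually_le_parallelSurface (n := n) (s := max (s - n) 0) hβ hβ1
    (le_max_right _ _) (max_lt (by linarith) hβ)
  refine liminf_div_ne_zero hc (mul_pos (sub_pos.2 hsd) (kappa_pos (sub_pos.2 hsd).le)) ?_
  filter_upwards [h, Ioo_mem_nhdsGT (zero_lt_one (α := ℝ))] with r hr hr1
  refine (ENNReal.ofReal_le_ofReal (mul_le_mul_of_nonneg_left ?_ hc.le)).trans hr
  refine Real.rpow_le_rpow_of_exponent_ge hr1.1 hr1.2.le ?_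
  push_cast
  linarith [le_max_left (s - n) 0]

theorem lowerSContent_concentricSpheres_eq_zero (hβ : 0 < β) (hβ1 : β ≤ 1) {s : ℝ}
    (hs : n + β < s) : lowerSContent s (concentricSpheres n (scaleExponent β)) = 0 := by
  rw [lowerSContent]
  -- If `β = 1`, then `n + β = d` and only the conventional value `0` for `s ≥ d` is used.
  split_ifs with hsd
  · refine liminf_div_eq_zero (mul_pos (sub_pos.2 hsd) (kappa_pos (sub_pos.2 hsd).le))
      fun η hη => ?_
    have h := frequently_parallelSurface_le (n := n) (s := s - n) hβ hβ1 (by linarith) hη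
    have e : -(s - n) = ((n + 1 : ℕ) : ℝ) - 1 - s := by push_cast; ring
    rwa [e] at h
  · rfl

theorem lowerSDim_concentricSpheres (hβ : 0 < β) (hβ1 : β ≤ 1) :
    lowerSDim (concentricSpheres n (scaleExponent β)) = n + β := by
  have hmem : ∀ s : ℝ, n + β < s →
      s ∈ {t : ℝ | 0 ≤ t ∧ lowerSContent t (concentricSpheres n (scaleExponent β)) = 0} :=
    fun s hs => ⟨by have : (0 : ℝ) ≤ n := n.cast_nonneg
                    linarith, lowerSContent_concentricSpheres_eq_zero hβ hβ1 hs⟩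
  refine csInf_eq_of_forall_ge_of_forall_gt_exists_lt ⟨_, hmem (n + β + 1) (by linarith)⟩
    (fun s hs => not_lt.1 fun h => lowerSContent_concentricSpheres_ne_zero hβ hβ1 h hs.2)
    fun w hw => ?_
  obtain ⟨s, h1, h2⟩ := exists_between hw
  exact ⟨s, hmem s h1, h2⟩

theorem exists_isCompact_mul_lowerMinkowskiDim_eq_lowerSDim {d : ℕ} (hd : 1 ≤ d) {c : ℝ}
    (hc : ((d : ℝ) - 1) / d < c) (hc1 : c ≤ 1) :
    ∃ A : Set (EuclideanSpace ℝ (Fin d)), IsCompact A ∧ volume A = 0 ∧ 0 < lowerMinkowskiDim A ∧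
      c * lowerMinkowskiDim A = lowerSDim A := by
  obtain ⟨n, rfl⟩ := Nat.exists_eq_add_of_le' hd
  have hn : (0 : ℝ) < (n + 1 : ℕ) := by positivity
  rw [div_lt_iff₀ hn] at hc
  have hβ : 0 < c * (n + 1 : ℕ) - n := by push_cast at hc ⊢; linarith
  have hβ1 : c * (n + 1 : ℕ) - n ≤ 1 := by push_cast at hn ⊢; nlinarith
  refine ⟨concentricSpheres n (scaleExponent (c * (n + 1 : ℕ) - n)), isCompact_concentricSpheres
    (strictMono_scaleExponent hβ hβ1) (succ_le_scaleExponent hβ hβ1), volume_concentricSpheres,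
    ?_, ?_⟩
  · rwa [lowerMinkowskiDim_concentricSpheres hβ hβ1]
  · rw [lowerMinkowskiDim_concentricSpheres hβ hβ1, lowerSDim_concentricSpheres hβ hβ1]
    ring

end

end ParallelSets

theorem mainTheorem3 (d : ℕ) (hd : 1 ≤ d) :
    (∀ c : ℝ, ((d : ℝ) - 1) / (d : ℝ) < c → c ≤ 1 →
      ∃ A : Set (EuclideanSpace ℝ (Fin d)),
        IsCompact A ∧ volume A = 0 ∧ 0 < ParallelSets.lowerMinkowskiDim A ∧
          c * ParallelSets.lowerMinkowskiDim A = ParallelSets.lowerSDim A) ∧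
    (∀ c : ℝ,
      (∀ A : Set (EuclideanSpace ℝ (Fin d)), IsCompact A → volume A = 0 →
        c * ParallelSets.lowerMinkowskiDim A ≤ ParallelSets.lowerSDim A) →
      c ≤ ((d : ℝ) - 1) / (d : ℝ)) := by
  have hi := fun c : ℝ => ParallelSets.exists_isCompact_mul_lowerMinkowskiDim_eq_lowerSDim hd (c := c)
  refine ⟨hi, fun c hc => not_lt.1 fun hlt => ?_⟩
  have hd1 : ((d : ℝ) - 1) / d < 1 := by
    rw [div_lt_one (by exact_mod_cast hd)]
    linarith
  -- The bound by `1` is needed because `c` may exceed the range covered by (i).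
  obtain ⟨c', h1, h2⟩ := exists_between (lt_min hlt hd1)
  obtain ⟨A, hA, hA0, hpos, heq⟩ := hi c' h1 (h2.le.trans (min_le_right _ _))
  have := hc A hA hA0
  rw [← heq] at this
  exact (le_of_mul_le_mul_right this hpos).not_gt (h2.trans_le (min_le_left _ _))
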